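/- Let $d\neq 1$ be a squarefree integer, let $F=\mathbb{Q}(\sqrt d)$, and let $\Delta_F$ be the discriminant of $F$. Let $\ell$ be an odd prime and let $K$ be an extension of $F$ of one of the following two kinds: (a) $K/\mathbb{Q}$ is a Galois extension whose Galois group is the dihedral group of order $2\ell$, and $[K:F]=\ell$; or (b) $\ell$ divides the class number of $F$, and $K/F$ is an abelian extension of degree $\ell^n$ for some integer $n\ge 1$ in which every prime ideal is unramified. Let $p$ be a (positive) prime number with $p\equiv 3 \pmod 8$, and let $H_K(p,2)$ be the quaternion algebra over $K$ with basis $1,i,j,ij$ and relations $i^2=p$, $j^2=2$, $ij=-ji$. Then $H_K(p,2)$ is a division algebra if and only if $\left(\frac{\Delta_F}{p}\right)=1$ or $d\equiv 1\pmod 8$, where $\left(\frac{\cdot}{p}\right)$ is the Legendre symbol (equal to $0$ on multiples of $p$). -/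

import Mathlib

open scoped Quaternion NumberField

/-- A nonzero ring `A` is a division algebra if for all `a ≠ 0` and `b` each of the equations
`a * x = b` and `y * a = b` has exactly one solution. -/
def IsDivisionAlgebra (A : Type*) [Ring A] : Prop :=
  Nontrivial A ∧ ∀ a b : A, a ≠ 0 → (∃! x : A, a * x = b) ∧ (∃! y : A, y * a = b)

/-- `F` is the field `ℚ(√d)`. -/
def IsQuadraticFieldOf (d : ℤ) (F : Type*) [Field F] [NumberField F] : Prop :=
  ∃ s : F, s ^ 2 = (d : F) ∧ IntermediateField.adjoin ℚ {s} = ⊤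

/-- `K` is a dihedral extension of `ℚ` (Galois, with group the dihedral group of order `2 * l`)
of degree `l` over its subfield `F`. -/
def IsDihedralExtension (l : ℕ) (F K : Type*) [Field F] [NumberField F]
    [Field K] [NumberField K] [Algebra F K] : Prop :=
  IsGalois ℚ K ∧ Nonempty ((K ≃ₐ[ℚ] K) ≃* DihedralGroup l) ∧ Module.finrank F K = l

/-- `l` divides the class number of `F`, and `K / F` is an abelian extension of degree `l ^ n`,
`n ≥ 1`, such that every prime ideal of `𝓞 K` is unramified over `𝓞 F`. -/
def IsUnramifiedAbelianExtension (l : ℕ) (F K : Type*) [Field F] [NumberField F]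
    [Field K] [NumberField K] [Algebra F K] : Prop :=
  l ∣ NumberField.classNumber F ∧ IsGalois F K ∧ (∀ σ τ : K ≃ₐ[F] K, σ * τ = τ * σ) ∧
    (∃ n : ℕ, 1 ≤ n ∧ Module.finrank F K = l ^ n) ∧
    ∀ (P : Ideal (𝓞 K)) [P.IsPrime], Algebra.IsUnramifiedAt (𝓞 F) P

/-! If the conic `x² = p y² + 2 z²` has no point over `K`, the quaternion norm form is anisotropic
and the algebra is a division algebra. As `[K : F]` is a power of the odd `ℓ`, a point over `K`
would give one over `F` (`ConicIsotropic.of_odd_finrank`). If `p` splits in `F`, or `d ≡ 1 [ZMOD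
8]`, then `F` embeds in `ℚ_p` or in `ℚ_2`; for `p ≡ 3 mod 8` the conic has no point over either
field.

Conversely, when both conditions fail, the norm form vanishes at some `√d w + x i + y j + z ij` with
rational `w, x, y, z`; equivalently, `d w² - 2 y² = p (x² - 2 z²)` has a nontrivial rational zero
(`exists_rat_zero`). To find it, both sides are made to take a common value `-p q / k` up to
squares, with `k ∈ {1, 2}` and `q` an auxiliary prime. This splits the equation into two conics,
solved by Legendre's local-global theorem (`ConicIsotropic.rat_of_local`). The local conditions
become congruences on `q`, met by Dirichlet's theorem, and the condition that `d` be a square mod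
`q`, which reciprocity secures in every case allowed by the hypotheses. -/

/-- The conic `x ^ 2 = a * y ^ 2 + b * z ^ 2` has a rational point over `K`. -/
def ConicIsotropic {K : Type*} [Field K] (a b : K) : Prop :=
  ∃ x y z : K, ¬(x = 0 ∧ y = 0 ∧ z = 0) ∧ x ^ 2 = a * y ^ 2 + b * z ^ 2

/-! ### Elementary operations on conics -/

namespace ConicIsotropic

variable {K : Type*} [Field K]

theorem symm {a b : K} (h : ConicIsotropic a b) : ConicIsotropic b a := by
  obtain ⟨x, y, z, h0, h⟩ := h
  exact ⟨x, z, y, by tauto, by rw [h, add_comm]⟩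

theorem of_isSquare_left {a : K} (b : K) (h : IsSquare a) : ConicIsotropic a b := by
  obtain ⟨t, rfl⟩ := h
  exact ⟨t, 1, 0, by simp, by ring⟩

theorem of_isSquare_neg_mul {a b : K} (ha : a ≠ 0) (h : IsSquare (-(a * b))) :
    ConicIsotropic a b := by
  obtain ⟨t, ht⟩ := h
  exact ⟨0, t, a, by simp [ha], by linear_combination a * ht⟩

/-- Since `t² - a` is the norm of `t + √a`, the coefficients `b` and `c` differ by a norm up to
squares. The witness comes from the product `(x + y√a)(t + √a)`. -/
theorem of_norm_eq {a b c t : K} (hb : b ≠ 0) (ht : t ^ 2 - a = b * c)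
    (h : ConicIsotropic a b) : ConicIsotropic a c := by
  obtain ⟨x, y, z, h0, h⟩ := h
  by_cases hz : z = 0
  · exact ⟨x, y, 0, by simpa [hz] using h0, by simpa [hz] using h⟩
  · refine ⟨x * t + a * y, x + y * t, b * z, by simp [hb, hz], ?_⟩
    linear_combination (t ^ 2 - a) * h + b * z ^ 2 * ht

theorem mul_sq_iff {a b k : K} (hk : k ≠ 0) :
    ConicIsotropic a (b * k ^ 2) ↔ ConicIsotropic a b := by
  constructor
  · rintro ⟨x, y, z, h0, h⟩
    exact ⟨x, y, k * z, by simpa [hk] using h0, by rw [h]; ring⟩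
  · rintro ⟨x, y, z, h0, h⟩
    exact ⟨x, y, z / k, by simpa [hk] using h0, by rw [h]; field_simp⟩

theorem map {L : Type*} [Field L] (f : K →+* L) {a b : K} (h : ConicIsotropic a b) :
    ConicIsotropic (f a) (f b) := by
  obtain ⟨x, y, z, h0, h⟩ := h
  refine ⟨f x, f y, f z, by simpa using h0, ?_⟩
  rw [← map_pow, h]
  simp

end ConicIsotropic

/-! ### Square roots modulo squarefree integers -/

theorem ZMod.isSquare_intCast_of_squarefree (a : ℤ) {n : ℕ} (hn : Squarefree n)
    (h : ∀ r : ℕ, r.Prime → r ∣ n → IsSquare (a : ZMod r)) : IsSquare (a : ZMod n) := by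
  induction n using induction_on_primes with
  | zero => simp at hn
  | one => exact ⟨0, Subsingleton.elim _ _⟩
  | prime_mul p m hp ih =>
    have hc : p.Coprime m := Nat.coprime_of_squarefree_mul hn
    obtain ⟨u, hu⟩ := h p hp (dvd_mul_right _ _)
    obtain ⟨v, hv⟩ := ih (hn.of_mul_right) fun r hr hrm => h r hr (hrm.mul_left _)
    let e := ZMod.chineseRemainder hc
    refine ⟨e.symm (u, v), e.injective ?_⟩
    rw [map_mul, e.apply_symm_apply, map_intCast]
    exact Prod.ext hu hv

theorem Int.exists_mul_eq_sq_sub_of_isSquare {a : ℤ} {b : ℤ} (hb : b ≠ 0)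
    (h : IsSquare (a : ZMod b.natAbs)) : ∃ t c : ℤ, t ^ 2 - a = b * c ∧ 2 * |t| ≤ |b| := by
  obtain ⟨u, hu⟩ := h
  have : NeZero b.natAbs := ⟨by simpa using hb⟩
  refine ⟨u.valMinAbs, ?_⟩
  have h1 : ((u.valMinAbs ^ 2 - a : ℤ) : ZMod b.natAbs) = 0 := by
    push_cast
    rw [hu]; ring
  rw [ZMod.intCast_zmod_eq_zero_iff_dvd, Int.natAbs_dvd] at h1
  obtain ⟨c, hc⟩ := h1
  refine ⟨c, hc, ?_⟩
  have := ZMod.natAbs_valMinAbs_le u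
  rw [Int.abs_eq_natAbs, Int.abs_eq_natAbs]
  omega

/-! ### Primitive `r`-adic points and the necessary condition at `r` -/

section Padic

variable {r : ℕ} [Fact r.Prime]

theorem Padic.exists_primitive {x y z : ℚ_[r]} (h0 : ¬(x = 0 ∧ y = 0 ∧ z = 0)) :
    ∃ (c : ℚ_[r]) (u v w : ℤ_[r]), c ≠ 0 ∧ x = c * u ∧ y = c * v ∧ z = c * w ∧
      ¬(‖u‖ < 1 ∧ ‖v‖ < 1 ∧ ‖w‖ < 1) := by
  -- The scaling factor is a coordinate of largest norm.
  obtain ⟨c, hc0, hx, hy, hz, hm⟩ : ∃ c : ℚ_[r], c ≠ 0 ∧ ‖x‖ ≤ ‖c‖ ∧ ‖y‖ ≤ ‖c‖ ∧ ‖z‖ ≤ ‖c‖ ∧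
      (c = x ∨ c = y ∨ c = z) := by
    have key : ∃ c : ℚ_[r], ‖x‖ ≤ ‖c‖ ∧ ‖y‖ ≤ ‖c‖ ∧ ‖z‖ ≤ ‖c‖ ∧ (c = x ∨ c = y ∨ c = z) := by
      rcases le_total ‖x‖ ‖y‖ with h1 | h1 <;> rcases le_total ‖y‖ ‖z‖ with h2 | h2 <;>
        rcases le_total ‖x‖ ‖z‖ with h3 | h3
      · exact ⟨z, h3, h2, le_rfl, by simp⟩
      · exact ⟨z, h1.trans h2, h2, le_rfl, by simp⟩
      · exact ⟨y, h1, le_rfl, h2, by simp⟩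
      · exact ⟨y, h1, le_rfl, h2, by simp⟩
      · exact ⟨z, h3, h2, le_rfl, by simp⟩
      · exact ⟨x, le_rfl, h1, h3, by simp⟩
      · exact ⟨x, le_rfl, h1, h2.trans h1, by simp⟩
      · exact ⟨x, le_rfl, h1, h3, by simp⟩
    obtain ⟨c, hx, hy, hz, hm⟩ := key
    refine ⟨c, ?_, hx, hy, hz, hm⟩
    rintro rfl
    simp only [norm_zero, norm_le_zero_iff] at hx hy hz
    exact h0 ⟨hx, hy, hz⟩
  have hc : 0 < ‖c‖ := norm_pos_iff.2 hc0
  have hle : ∀ t : ℚ_[r], ‖t‖ ≤ ‖c‖ → ‖t / c‖ ≤ 1 := fun t ht => by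
    rw [norm_div, div_le_one hc]; exact ht
  refine ⟨c, ⟨x / c, hle x hx⟩, ⟨y / c, hle y hy⟩, ⟨z / c, hle z hz⟩, hc0,
    by simp; field_simp, by simp; field_simp, by simp; field_simp, ?_⟩
  rintro ⟨h1, h2, h3⟩
  change ‖x / c‖ < 1 at h1
  change ‖y / c‖ < 1 at h2
  change ‖z / c‖ < 1 at h3
  rcases hm with rfl | rfl | rfl
  · simp [hc0] at h1
  · simp [hc0] at h2
  · simp [hc0] at h3

theorem ConicIsotropic.exists_padicInt {a b : ℤ} (h : ConicIsotropic (a : ℚ_[r]) b) :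
    ∃ u v w : ℤ_[r], u ^ 2 = a * v ^ 2 + b * w ^ 2 ∧ ¬(‖u‖ < 1 ∧ ‖v‖ < 1 ∧ ‖w‖ < 1) := by
  obtain ⟨x, y, z, h0, h⟩ := h
  obtain ⟨c, u, v, w, hc, rfl, rfl, rfl, hu⟩ := Padic.exists_primitive h0
  refine ⟨u, v, w, ?_, hu⟩
  have : (c ^ 2) * (u : ℚ_[r]) ^ 2 = c ^ 2 * (a * v ^ 2 + b * w ^ 2) := by
    linear_combination h
  have := mul_left_cancel₀ (pow_ne_zero 2 hc) this
  apply PadicInt.ext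
  push_cast
  exact this

theorem PadicInt.toZMod_eq_zero_iff {u : ℤ_[r]} : PadicInt.toZMod u = 0 ↔ ‖u‖ < 1 := by
  rw [← RingHom.mem_ker, PadicInt.ker_toZMod, PadicInt.mem_nonunits.symm]
  rfl

/-- Reduce a primitive point mod `r`: `u² = a v²`. If `r` divided `v`, it would divide `u`, and then
`w` because `r` divides `b` only once, against primitivity. -/
theorem ConicIsotropic.isSquare_of_dvd {a b : ℤ} (h : ConicIsotropic (a : ℚ_[r]) b)
    (hb : (r : ℤ) ∣ b) (hb2 : ¬ (r : ℤ) ^ 2 ∣ b) : IsSquare (a : ZMod r) := by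
  obtain ⟨u, v, w, h, hu⟩ := h.exists_padicInt
  simp only [← PadicInt.toZMod_eq_zero_iff] at hu
  have hm := congrArg PadicInt.toZMod h
  have hb0 : (b : ZMod r) = 0 := by rwa [ZMod.intCast_zmod_eq_zero_iff_dvd]
  simp only [map_pow, map_add, map_mul, map_intCast, hb0, zero_mul, add_zero] at hm
  by_cases hv : PadicInt.toZMod v = 0
  · exfalso
    have hu0 : PadicInt.toZMod u = 0 := by simpa [hv] using hm
    apply hu
    refine ⟨hu0, hv, ?_⟩
    rw [PadicInt.toZMod_eq_zero_iff, PadicInt.norm_lt_one_iff_dvd] at hu0 hv ⊢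
    obtain ⟨u', rfl⟩ := hu0
    obtain ⟨v', rfl⟩ := hv
    obtain ⟨c, rfl⟩ := hb
    have hr : (r : ℤ_[r]) ≠ 0 := by exact_mod_cast (Fact.out : r.Prime).ne_zero
    have h1 : (c : ℤ_[r]) * w ^ 2 = r * (u' ^ 2 - a * v' ^ 2) := by
      apply mul_left_cancel₀ hr
      push_cast at h
      linear_combination -h
    have hp : Prime (r : ℤ_[r]) := PadicInt.prime_p
    rcases hp.dvd_or_dvd (Dvd.intro _ h1.symm) with h2 | h2
    · exfalso
      apply hb2
      have : (r : ℤ) ∣ c := by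
        have := (PadicInt.norm_int_lt_one_iff_dvd (p := r) c).1
          ((PadicInt.norm_lt_one_iff_dvd _).2 h2)
        exact this
      rw [pow_two]
      exact mul_dvd_mul_left _ this
    · exact hp.dvd_of_dvd_pow h2
  · exact ⟨PadicInt.toZMod u / PadicInt.toZMod v, by field_simp; exact hm.symm⟩

end Padic

/-! ### Legendre's descent -/

/-- The local-global principle for conics; the place `2` may be left out. -/
theorem ConicIsotropic.rat_of_local {a b : ℤ} (ha : a ≠ 0) (hb : b ≠ 0)
    (hR : ConicIsotropic (a : ℝ) b)
    (hp : ∀ (r : ℕ) [Fact r.Prime], r ≠ 2 → ConicIsotropic (a : ℚ_[r]) b) :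
    ConicIsotropic (a : ℚ) b := by
  induction hn : a.natAbs + b.natAbs using Nat.strong_induction_on generalizing a b with
  | _ n ih =>
  wlog hab : a.natAbs ≤ b.natAbs generalizing a b
  · exact (this hb ha hR.symm (fun r _ hr => (hp r hr).symm) (by omega) (by omega)).symm
  by_cases hsq : Squarefree b
  · by_cases hb1 : b.natAbs = 1
    · have ha1 : a.natAbs = 1 := by omega
      rcases Int.natAbs_eq a with h | h <;> rw [ha1] at h
      · exact of_isSquare_left _ ⟨1, by simp [h]⟩
      rcases Int.natAbs_eq b with h' | h' <;> rw [hb1] at h'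
      · exact (of_isSquare_left _ ⟨1, by simp [h']⟩).symm
      · exfalso
        obtain ⟨x, y, z, h0, e⟩ := hR
        rw [h, h'] at e
        push_cast at e
        have hx : x = 0 := by nlinarith [sq_nonneg x, sq_nonneg y, sq_nonneg z]
        have hy : y = 0 := by nlinarith [sq_nonneg x, sq_nonneg y, sq_nonneg z]
        have hz : z = 0 := by nlinarith [sq_nonneg x, sq_nonneg y, sq_nonneg z]
        exact h0 ⟨hx, hy, hz⟩
    · have hsq' : IsSquare (a : ZMod b.natAbs) := by
        refine ZMod.isSquare_intCast_of_squarefree a (Int.squarefree_natAbs.2 hsq) ?_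
        intro r hr hrb
        have : Fact r.Prime := ⟨hr⟩
        -- Everything is a square mod `2`, so the descent needs no information at that place.
        rcases eq_or_ne r 2 with rfl | h2
        · generalize (a : ZMod 2) = c
          revert c
          decide
        · refine (hp r h2).isSquare_of_dvd (Int.natCast_dvd.2 hrb) fun h => ?_
          rw [pow_two] at h
          have := hsq _ h
          rw [Int.isUnit_iff] at this
          have := hr.two_le
          omega
      obtain ⟨t, c, htc, ht⟩ := Int.exists_mul_eq_sq_sub_of_isSquare hb hsq'
      have htc' : ∀ (L : Type) [Field L], (t : L) ^ 2 - a = b * c := fun L _ => by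
        exact_mod_cast congrArg (Int.cast : ℤ → L) htc
      rcases eq_or_ne c 0 with rfl | hc
      · refine of_isSquare_left _ ⟨t, ?_⟩
        have := htc' ℚ
        push_cast at this
        linear_combination -this
      have hbc : (b : ℚ) ≠ 0 := by exact_mod_cast hb
      have hcc : (c : ℚ) ≠ 0 := by exact_mod_cast hc
      refine of_norm_eq hcc (t := (t : ℚ)) (by rw [htc' ℚ, mul_comm]) ?_
      refine ih (a.natAbs + c.natAbs) ?_ ha hc
        (of_norm_eq (by exact_mod_cast hb) (htc' ℝ) hR)
        (fun r _ hr => of_norm_eq (by exact_mod_cast hb) (htc' _) (hp r hr)) rfl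
      -- With `|t| ≤ |b|/2` and `|a| ≤ |b|` this gives `|b||c| ≤ b²/4 + |b| < b²` once `|b| ≥ 2`, so
      -- the coefficient shrinks.
      have h1 : |b| * |c| ≤ t ^ 2 + |a| := by
        rw [← abs_mul, ← htc]
        refine (abs_sub _ _).trans ?_
        simp
      have h2 : |a| ≤ |b| := by
        rw [Int.abs_eq_natAbs, Int.abs_eq_natAbs]; exact_mod_cast hab
      have h3 : 2 ≤ |b| := by rw [Int.abs_eq_natAbs]; omega
      have h4 : |c| < |b| := by
        have := sq_abs t
        by_contra! hcon
        nlinarith [abs_nonneg t]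
      rw [Int.abs_eq_natAbs, Int.abs_eq_natAbs] at h4
      omega
  · obtain ⟨k, hkb, hk⟩ : ∃ k : ℤ, k * k ∣ b ∧ ¬ IsUnit k := by
      simpa [Squarefree] using hsq
    obtain ⟨c, rfl⟩ := hkb
    have hk0 : k ≠ 0 := by rintro rfl; simp at hb
    have hc0 : c ≠ 0 := by rintro rfl; simp at hb
    have hcast : ∀ (L : Type) [Field L] [CharZero L],
        ConicIsotropic (a : L) ((k * k * c : ℤ) : L) ↔ ConicIsotropic (a : L) c := by
      intro L _ _
      rw [← mul_sq_iff (b := (c : L)) (k := (k : L)) (by exact_mod_cast hk0)]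
      push_cast
      rw [show (k : L) * k * c = c * k ^ 2 by ring]
    rw [hcast] at hR ⊢
    refine ih (a.natAbs + c.natAbs) ?_ ha hc0 hR
      (fun r _ hr => (hcast _).1 (hp r hr)) rfl
    rw [← hn, Int.natAbs_mul, Int.natAbs_mul]
    have hk1 : k.natAbs ≠ 1 := by rwa [Int.isUnit_iff_natAbs_eq] at hk
    have hk2 : 2 ≤ k.natAbs := by
      have : k.natAbs ≠ 0 := by simpa using hk0
      omega
    have h1 : 0 < c.natAbs := Int.natAbs_pos.2 hc0
    have h2 := Nat.mul_le_mul_right c.natAbs (Nat.mul_le_mul hk2 hk2)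
    omega

/-! ### Hensel lifting: sufficient local conditions -/

section Padic

variable {r : ℕ} [Fact r.Prime]

theorem Padic.isSquare_intCast_of_zmod (hr : r ≠ 2) {a : ℤ} (ha : ¬ (r : ℤ) ∣ a)
    (h : IsSquare (a : ZMod r)) : IsSquare (a : ℚ_[r]) := by
  obtain ⟨t, ht⟩ := h
  obtain ⟨t, rfl⟩ := ZMod.intCast_surjective t
  have hdvd : (r : ℤ) ∣ t ^ 2 - a := by
    rw [← ZMod.intCast_zmod_eq_zero_iff_dvd]
    push_cast
    rw [ht]; ring
  have ht2 : ¬ (r : ℤ) ∣ 2 * t := by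
    intro h
    have hp : Prime (r : ℤ) := Nat.prime_iff_prime_int.1 Fact.out
    rcases hp.dvd_or_dvd h with h | h
    · have : r ∣ 2 := by exact_mod_cast h
      exact hr ((Nat.prime_dvd_prime_iff_eq Fact.out Nat.prime_two).1 this)
    · apply ha
      have := (dvd_pow h two_ne_zero).sub hdvd
      simpa using this
  have h1 : ‖((2 * t : ℤ) : ℤ_[r])‖ = 1 :=
    le_antisymm (PadicInt.norm_le_one _)
      (not_lt.1 fun h => ht2 ((PadicInt.norm_int_lt_one_iff_dvd _).1 h))
  obtain ⟨z, hz, -⟩ := hensels_lemma (F := (Polynomial.X ^ 2 - Polynomial.C a : Polynomial ℤ))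
    (a := ((t : ℤ) : ℤ_[r])) (by
      have h2 : ‖((t ^ 2 - a : ℤ) : ℤ_[r])‖ < 1 := (PadicInt.norm_int_lt_one_iff_dvd _).2 hdvd
      simp only [map_sub, map_pow, Polynomial.aeval_X, Polynomial.derivative_X_pow, Polynomial.derivative_C, Polynomial.aeval_C]
      have h3 : Polynomial.aeval ((t : ℤ) : ℤ_[r]) (2 : Polynomial ℤ) = 2 := map_ofNat _ 2
      push_cast at h1 h2
      simpa [h1, h3, ← norm_mul] using h2)
  refine ⟨z, ?_⟩
  have hz' : z ^ 2 - (a : ℤ_[r]) = 0 := by simpa using hz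
  have := congrArg (Subtype.val) hz'
  push_cast at this
  linear_combination -this

theorem Padic.isSquare_intCast_two {a : ℤ} (ha : a ≡ 1 [ZMOD 8]) : IsSquare (a : ℚ_[2]) := by
  have hdvd : (2 : ℤ) ^ 3 ∣ 1 - a := ha.dvd
  obtain ⟨z, hz, -⟩ := hensels_lemma (F := (Polynomial.X ^ 2 - Polynomial.C a : Polynomial ℤ))
    (a := (1 : ℤ_[2])) (by
      -- Hensel at the approximate root `1` requires norm below `‖2‖² = 1/4`; the congruence mod `8`
      -- provides `1/8`.
      have h2 : ‖((1 - a : ℤ) : ℤ_[2])‖ ≤ (2 : ℝ) ^ (-(3 : ℤ)) :=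
        by
        have := (PadicInt.norm_int_le_pow_iff_dvd (p := 2) (k := 1 - a) (n := 3)).2
          (by exact_mod_cast hdvd)
        exact_mod_cast this
      have h3 : ‖(2 : ℤ_[2])‖ = 2⁻¹ := by simpa using PadicInt.norm_p (p := 2)
      simp only [map_sub, map_pow, Polynomial.aeval_X, Polynomial.derivative_X_pow, Polynomial.derivative_C, Polynomial.aeval_C]
      push_cast at h2
      have h4 : Polynomial.aeval (1 : ℤ_[2]) (2 : Polynomial ℤ) = 2 := map_ofNat _ 2
      norm_num at h2 ⊢
      rw [h4, h3]
      linarith)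
  refine ⟨z, ?_⟩
  have hz' : z ^ 2 - (a : ℤ_[2]) = 0 := by simpa using hz
  have := congrArg (Subtype.val) hz'
  push_cast at this
  linear_combination -this

theorem ConicIsotropic.padic_of_isSquare (hr : r ≠ 2) {a : ℤ} (b : ℤ) (ha : ¬ (r : ℤ) ∣ a)
    (h : IsSquare (a : ZMod r)) : ConicIsotropic (a : ℚ_[r]) b :=
  of_isSquare_left _ (Padic.isSquare_intCast_of_zmod hr ha h)

/-- Over the finite field, `a y² + b z²` takes the value `1`; an integer congruent to `1` mod `r` is
then an `r`-adic square. -/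
theorem ConicIsotropic.padic_of_not_dvd (hr : r ≠ 2) {a b : ℤ} (ha : ¬ (r : ℤ) ∣ a)
    (hb : ¬ (r : ℤ) ∣ b) : ConicIsotropic (a : ℚ_[r]) b := by
  obtain ⟨y, z, h⟩ : ∃ y z : ZMod r, (a : ZMod r) * y ^ 2 + b * z ^ 2 = 1 := by
    have ha' : (a : ZMod r) ≠ 0 := by rwa [Ne, ZMod.intCast_zmod_eq_zero_iff_dvd]
    have hb' : (b : ZMod r) ≠ 0 := by rwa [Ne, ZMod.intCast_zmod_eq_zero_iff_dvd]
    obtain ⟨y, z, h⟩ := FiniteField.exists_root_sum_quadratic (R := ZMod r)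
      (f := Polynomial.C (a : ZMod r) * Polynomial.X ^ 2 + Polynomial.C 0 * Polynomial.X
        + Polynomial.C 0)
      (g := Polynomial.C (b : ZMod r) * Polynomial.X ^ 2 + Polynomial.C 0 * Polynomial.X
        + Polynomial.C (-1))
      (Polynomial.degree_quadratic ha') (Polynomial.degree_quadratic hb')
      (by rw [ZMod.card]; exact Nat.odd_iff.1 ((Fact.out : r.Prime).odd_of_ne_two hr))
    refine ⟨y, z, ?_⟩
    simp at h
    linear_combination h
  obtain ⟨y, rfl⟩ := ZMod.intCast_surjective y
  obtain ⟨z, rfl⟩ := ZMod.intCast_surjective z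
  have h1 : ((a * y ^ 2 + b * z ^ 2 : ℤ) : ZMod r) = 1 := by push_cast; exact h
  obtain ⟨x, hx⟩ := Padic.isSquare_intCast_of_zmod (r := r) hr (a := a * y ^ 2 + b * z ^ 2)
    (by rw [← ZMod.intCast_zmod_eq_zero_iff_dvd, h1]; exact one_ne_zero) (by rw [h1]; exact ⟨1, by simp⟩)
  refine ⟨x, y, z, ?_, ?_⟩
  · rintro ⟨-, hy, hz⟩
    have hy : y = 0 := by exact_mod_cast hy
    have hz : z = 0 := by exact_mod_cast hz
    simp [hy, hz] at h1
  · push_cast at hx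
    rw [hx]; ring

theorem ConicIsotropic.padic_of_dvd_of_dvd (hr : r ≠ 2) {a b : ℤ} (ha : ¬ (r : ℤ) ∣ a)
    (hb : ¬ (r : ℤ) ∣ b) (h : IsSquare ((-(a * b) : ℤ) : ZMod r)) :
    ConicIsotropic ((r * a : ℤ) : ℚ_[r]) ((r * b : ℤ) : ℚ_[r]) := by
  have hp : Prime (r : ℤ) := Nat.prime_iff_prime_int.1 Fact.out
  obtain ⟨t, ht⟩ := Padic.isSquare_intCast_of_zmod hr
    (by rw [dvd_neg, hp.dvd_mul]; tauto) h
  refine of_isSquare_neg_mul ?_ ⟨r * t, ?_⟩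
  · have : a ≠ 0 := by rintro rfl; simp at ha
    have h2 := hp.ne_zero
    exact_mod_cast mul_ne_zero h2 this
  · push_cast at ht ⊢
    linear_combination (r : ℚ_[r]) ^ 2 * ht

end Padic

/-! ### The conic of `(p, 2)` has no point at `p` or at `2` -/

theorem not_conicIsotropic_padic_self {p : ℕ} [Fact p.Prime] (hp : p % 8 = 3) :
    ¬ ConicIsotropic (p : ℚ_[p]) 2 := by
  intro h
  have h2 : ConicIsotropic ((2 : ℤ) : ℚ_[p]) ((p : ℤ) : ℚ_[p]) := by
    push_cast; exact h.symm
  have hs := h2.isSquare_of_dvd dvd_rfl (by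
    intro h
    have h3 : p ^ 2 ∣ p := by exact_mod_cast h
    have := Nat.le_of_dvd (by omega) h3
    have := (Fact.out : p.Prime).two_le
    nlinarith)
  have := (ZMod.exists_sq_eq_two_iff (p := p) (by omega)).1 (by exact_mod_cast hs)
  omega

theorem not_conicIsotropic_padic_two {p : ℕ} (hp : p % 8 = 3) :
    ¬ ConicIsotropic (p : ℚ_[2]) 2 := by
  intro h
  have h2 : ConicIsotropic ((p : ℤ) : ℚ_[2]) ((2 : ℤ) : ℚ_[2]) := by
    push_cast; exact h
  obtain ⟨u, v, w, h, hu⟩ := h2.exists_padicInt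
  apply hu
  -- In `ZMod 8`, `4 * x = 0` means that `x` is even: no solution mod `8` is primitive.
  have key : ∀ x y z : ZMod 8, x ^ 2 = 3 * y ^ 2 + 2 * z ^ 2 →
      4 * x = 0 ∧ 4 * y = 0 ∧ 4 * z = 0 := by decide
  have hm := congrArg (PadicInt.toZModPow (p := 2) 3) h
  simp only [map_pow, map_add, map_mul, map_intCast] at hm
  have h3 : (((p : ℤ)) : ZMod (2 ^ 3)) = 3 := by
    have : ((p : ℕ) : ZMod 8) = (3 : ℕ) := (ZMod.natCast_eq_natCast_iff _ _ _).2 hp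
    exact_mod_cast this
  rw [h3] at hm
  have hfin : ∀ t : ℤ_[2], (4 : ZMod (2 ^ 3)) * PadicInt.toZModPow 3 t = 0 → ‖t‖ < 1 := by
    intro t ht
    have h4 : PadicInt.toZModPow (p := 2) 3 (4 * t) = 0 := by
      rw [map_mul, map_ofNat]; exact ht
    rw [← RingHom.mem_ker, PadicInt.ker_toZModPow, Ideal.mem_span_singleton] at h4
    obtain ⟨c, hc⟩ := h4
    rw [PadicInt.norm_lt_one_iff_dvd]
    refine ⟨c, ?_⟩
    push_cast at hc ⊢
    have h5 : (4 : ℤ_[2]) ≠ 0 := by norm_num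
    apply mul_left_cancel₀ h5
    rw [hc]; ring
  obtain ⟨h5, h6, h7⟩ := key _ _ _ hm
  exact ⟨hfin _ h5, hfin _ h6, hfin _ h7⟩

/-! ### Descent through extensions of odd degree -/

theorem isSquare_of_odd_finrank {F K : Type*} [Field F] [Field K] [Algebra F K]
    (hodd : Odd (Module.finrank F K)) {a : F} (h : IsSquare (algebraMap F K a)) : IsSquare a := by
  obtain ⟨t, ht⟩ := h
  obtain ⟨k, hk⟩ := hodd
  by_cases ha : a = 0
  · exact ⟨0, by simp [ha]⟩
  have h1 := congrArg (Algebra.norm F) ht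
  rw [Algebra.norm_algebraMap, hk, map_mul] at h1
  refine ⟨Algebra.norm F t / a ^ k, ?_⟩
  field_simp
  rw [pow_two (Algebra.norm F t), ← h1]
  ring

/-- A conic that acquires a point over an extension of odd degree already has one. -/
theorem ConicIsotropic.of_odd_finrank {F K : Type*} [Field F] [Field K] [Algebra F K]
    [FiniteDimensional F K] (hodd : Odd (Module.finrank F K)) {a b : F} (hb : b ≠ 0)
    (h : ConicIsotropic (algebraMap F K a) (algebraMap F K b)) : ConicIsotropic a b := by
  obtain ⟨x, y, z, h0, h⟩ := h
  by_cases hz : z = 0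
  · refine of_isSquare_left _ (isSquare_of_odd_finrank hodd ⟨x / y, ?_⟩)
    have hy : y ≠ 0 := by
      rintro rfl
      simp [hz] at h
      exact h0 ⟨h, rfl, hz⟩
    field_simp
    rw [h, hz]
    ring
  -- `A` is the matrix of multiplication by `x + y√a`, over the quadratic algebra `F[ω]` with `ω² =
  -- a`. Taking determinants in `A · star A = b M(z)²` shows that `b ^ [K : F]` times a square is a
  -- norm; the odd exponent leaves one factor `b` outside the square. Only a commutative ring is
  -- needed, so `a` may be a square.
  let B := Module.finBasis F K
  let M := Algebra.leftMulMatrix B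
  let c : F →+* QuadraticAlgebra F a 0 := algebraMap F (QuadraticAlgebra F a 0)
  let w : QuadraticAlgebra F a 0 := QuadraticAlgebra.omega
  let A : Matrix _ _ (QuadraticAlgebra F a 0) := (M x).map c + w • (M y).map c
  have hw : w * w = c a := by
    ext <;> simp [w, c]
  have hM : M x * M x - a • (M y * M y) = b • (M z * M z) := by
    rw [← map_mul, ← map_mul, ← map_mul, ← map_smul, ← map_smul, ← map_sub]
    congr 1
    simp only [Algebra.smul_def]
    linear_combination h
  have hstar : (starRingEnd (QuadraticAlgebra F a 0)).mapMatrix A = (M x).map c - w • (M y).map c := by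
    ext i j <;> simp [A, c, w, starRingEnd_apply, sub_eq_add_neg]
  have hA : A * (starRingEnd (QuadraticAlgebra F a 0)).mapMatrix A = (b • (M z * M z)).map c := by
    have hcomm : (M x).map c * (M y).map c = (M y).map c * (M x).map c := by
      rw [← Matrix.map_mul, ← Matrix.map_mul, ← map_mul, ← map_mul, mul_comm]
    rw [hstar, ← hM]
    have h1 : (M x * M x - a • (M y * M y)).map c
        = (M x).map c * (M x).map c - c a • ((M y).map c * (M y).map c) := by
      rw [← Matrix.map_mul, ← Matrix.map_mul]
      ext i j : 1
      simp only [Matrix.map_apply, Matrix.sub_apply, Matrix.smul_apply, smul_eq_mul, map_sub,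
        map_mul]
    rw [h1, add_mul, mul_sub, mul_sub, smul_mul_assoc, smul_mul_assoc, mul_smul_comm,
      mul_smul_comm, hcomm, smul_smul, hw]
    abel
  have hdet := congrArg Matrix.det hA
  rw [Matrix.det_mul, ← RingHom.map_det, starRingEnd_apply,
    ← QuadraticAlgebra.algebraMap_norm_eq_mul_star] at hdet
  have h2 : ((b • (M z * M z)).map c).det = c ((b • (M z * M z)).det) := by
    rw [RingHom.map_det]; rfl
  rw [h2] at hdet
  have h3 := (algebraMap F (QuadraticAlgebra F a 0)).injective hdet
  rw [Matrix.det_smul, Matrix.det_mul, Fintype.card_fin, QuadraticAlgebra.norm_def] at h3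
  obtain ⟨k, hk⟩ := hodd
  generalize A.det = D at h3
  simp only [hk] at h3
  refine ⟨D.re, D.im, b ^ k * (M z).det, ?_, ?_⟩
  · have : (M z).det ≠ 0 := by
      rw [← Algebra.norm_eq_matrix_det]
      exact Algebra.norm_ne_zero_iff.2 hz
    simp [hb, this]
  · linear_combination h3

/-! ### Quaternion algebras and their norm forms -/

section Quaternion

variable {K : Type*} [Field K] {a b : K}

theorem QuaternionAlgebra.mul_star_eq_algebraMap (q : ℍ[K, a, b]) :
    q * star q = algebraMap K _ (q.re ^ 2 - a * q.imI ^ 2 - b * q.imJ ^ 2 + a * b * q.imK ^ 2) := by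
  rw [QuaternionAlgebra.algebraMap_eq]
  ext <;> simp <;> ring

theorem QuaternionAlgebra.star_mul_eq_algebraMap (q : ℍ[K, a, b]) :
    star q * q = algebraMap K _ (q.re ^ 2 - a * q.imI ^ 2 - b * q.imJ ^ 2 + a * b * q.imK ^ 2) := by
  rw [QuaternionAlgebra.algebraMap_eq]
  ext <;> simp <;> ring

theorem not_isDivisionAlgebra_of_norm_eq_zero {q : ℍ[K, a, b]} (hq : q ≠ 0)
    (h : q.re ^ 2 - a * q.imI ^ 2 - b * q.imJ ^ 2 + a * b * q.imK ^ 2 = 0) :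
    ¬ IsDivisionAlgebra ℍ[K, a, b] := by
  rintro ⟨-, hD⟩
  have h1 := q.mul_star_eq_algebraMap
  rw [h, map_zero] at h1
  have := (hD q 0 hq).1.unique h1 (mul_zero q)
  exact hq (by simpa using this)

theorem isDivisionAlgebra_of_not_conicIsotropic (h : ¬ ConicIsotropic a b) :
    IsDivisionAlgebra ℍ[K, a, b] := by
  have hN : ∀ q : ℍ[K, a, b], q ≠ 0 →
      q.re ^ 2 - a * q.imI ^ 2 - b * q.imJ ^ 2 + a * b * q.imK ^ 2 ≠ 0 := by
    intro q hq hn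
    by_cases h2 : q.imJ ^ 2 - a * q.imK ^ 2 = 0
    · by_cases h3 : q.imJ = 0 ∧ q.imK = 0
      · apply h
        refine ⟨q.re, q.imI, 0, ?_, ?_⟩
        · rintro ⟨h4, h5, -⟩
          exact hq (by ext <;> simp [h3, h4, h5])
        · linear_combination hn + b * h2
      · exact h ⟨q.imJ, q.imK, 0, by tauto, by linear_combination h2⟩
    -- The vanishing norm reads `N(re + imI√a) = b N(imJ + imK√a)`. The first two coordinates are
    -- those of `(re - imI√a)(imJ + imK√a)`, whose norm is `b` times the square of the third.
    · refine h ⟨q.re * q.imJ - a * q.imI * q.imK, q.re * q.imK - q.imI * q.imJ,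
        q.imJ ^ 2 - a * q.imK ^ 2, by tauto, ?_⟩
      linear_combination (q.imJ ^ 2 - a * q.imK ^ 2) * hn
  refine ⟨inferInstance, fun q r hq => ?_⟩
  set n := q.re ^ 2 - a * q.imI ^ 2 - b * q.imJ ^ 2 + a * b * q.imK ^ 2 with hn
  have hn0 : n ≠ 0 := hN q hq
  have hl : (n⁻¹ • star q) * q = 1 := by
    rw [smul_mul_assoc, q.star_mul_eq_algebraMap, ← hn]
    simp [Algebra.algebraMap_eq_smul_one, smul_smul, hn0]
  have hr : q * (n⁻¹ • star q) = 1 := by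
    rw [mul_smul_comm, q.mul_star_eq_algebraMap, ← hn]
    simp [Algebra.algebraMap_eq_smul_one, smul_smul, hn0]
  refine ⟨⟨(n⁻¹ • star q) * r, ?_, fun y hy => ?_⟩, ⟨r * (n⁻¹ • star q), ?_, fun y hy => ?_⟩⟩
  · simp only [← mul_assoc, hr, one_mul]
  · rw [← hy, ← mul_assoc, hl, one_mul]
  · simp only [mul_assoc, hl, mul_one]
  · rw [← hy, mul_assoc, hr, mul_one]

end Quaternion

/-! ### Embeddings of the quadratic field -/

section QuadraticField

variable {d : ℤ} {F : Type*} [Field F] [NumberField F]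

theorem not_isSquare_ratCast_of_squarefree (hd : Squarefree d) (hd1 : d ≠ 1) :
    ¬ IsSquare (d : ℚ) := by
  rw [Rat.isSquare_intCast_iff]
  rintro ⟨t, rfl⟩
  have := hd t dvd_rfl
  rw [Int.isUnit_iff] at this
  rcases this with rfl | rfl <;> simp at hd1

theorem minpoly_eq_X_sq_sub_C (hd : Squarefree d) (hd1 : d ≠ 1) {s : F} (hs : s ^ 2 = d) :
    minpoly ℚ s = Polynomial.X ^ 2 - Polynomial.C (d : ℚ) := by
  symm
  refine minpoly.eq_of_irreducible_of_monic ?_ (by simp [hs])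
    (Polynomial.monic_X_pow_sub_C _ two_ne_zero)
  refine (Polynomial.irreducible_iff_roots_eq_zero_of_degree_le_three
    (by rw [Polynomial.natDegree_X_pow_sub_C])
    (by rw [Polynomial.natDegree_X_pow_sub_C]; norm_num)).2 ?_
  refine Multiset.eq_zero_of_forall_notMem fun t ht => ?_
  have h := Polynomial.isRoot_of_mem_roots ht
  apply not_isSquare_ratCast_of_squarefree hd hd1
  refine ⟨t, ?_⟩
  simp only [Polynomial.IsRoot.def, Polynomial.eval_sub, Polynomial.eval_pow, Polynomial.eval_X,
    Polynomial.eval_C] at h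
  linear_combination -h

theorem IsQuadraticFieldOf.exists_ringHom (hF : IsQuadraticFieldOf d F) (hd : Squarefree d)
    (hd1 : d ≠ 1) {L : Type*} [Field L] [CharZero L] (h : IsSquare (d : L)) :
    Nonempty (F →+* L) := by
  obtain ⟨s, hs, htop⟩ := hF
  obtain ⟨t, ht⟩ := h
  have hmin := minpoly_eq_X_sq_sub_C hd hd1 hs
  have hint : IsIntegral ℚ s := Algebra.IsIntegral.isIntegral s
  let f : IntermediateField.adjoin ℚ {s} →ₐ[ℚ] L :=
    (IntermediateField.algHomAdjoinIntegralEquiv ℚ hint).symm ⟨t, by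
      rw [hmin, Polynomial.mem_aroots]
      refine ⟨Polynomial.X_pow_sub_C_ne_zero two_pos _, ?_⟩
      simp [ht, pow_two]⟩
  let g : F →ₐ[ℚ] IntermediateField.adjoin ℚ {s} :=
    ((IntermediateField.topEquiv.symm.trans (IntermediateField.equivOfEq htop.symm)) :
      F ≃ₐ[ℚ] IntermediateField.adjoin ℚ {s})
  exact ⟨(f.comp g).toRingHom⟩

end QuadraticField

/-! ### Comparing `d` with the discriminant -/

section Discriminant

variable {d : ℤ} {F : Type*} [Field F] [NumberField F]

/-- The family `1, √d` has discriminant `4d`; `k` is the determinant expressing it in an integral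
basis. -/
theorem IsQuadraticFieldOf.exists_sq_mul_discr (hF : IsQuadraticFieldOf d F) (hd : Squarefree d)
    (hd1 : d ≠ 1) : ∃ k : ℤ, 4 * d = k ^ 2 * NumberField.discr F := by
  obtain ⟨s, hs, htop⟩ := hF
  have hmin := minpoly_eq_X_sq_sub_C hd hd1 hs
  have hint : IsIntegral ℚ s := Algebra.IsIntegral.isIntegral s
  have htop' : Algebra.adjoin ℚ {s} = ⊤ := by
    rw [← IntermediateField.adjoin_simple_toSubalgebra_of_isAlgebraic hint.isAlgebraic, htop,
      IntermediateField.top_toSubalgebra]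
  let pb : PowerBasis ℚ F := PowerBasis.ofAdjoinEqTop hint htop'
  have hgen : pb.gen = s := by simp [pb]
  have hfin : Module.finrank ℚ F = 2 := by
    rw [pb.finrank, ← pb.natDegree_minpoly, hgen, hmin, Polynomial.natDegree_X_pow_sub_C]
  have htr : Algebra.trace ℚ F s = 0 := by
    have := PowerBasis.trace_gen_eq_nextCoeff_minpoly pb
    rw [hgen, hmin, Polynomial.nextCoeff_of_natDegree_pos
      (by rw [Polynomial.natDegree_X_pow_sub_C]; norm_num), Polynomial.natDegree_X_pow_sub_C] at this
    rw [this, Polynomial.coeff_sub, Polynomial.coeff_X_pow, Polynomial.coeff_C]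
    norm_num
  have hv : Algebra.discr ℚ ![(1 : F), s] = 4 * d := by
    have h1 : Algebra.trace ℚ F 1 = 2 := by
      have := Algebra.trace_algebraMap (R := ℚ) (S := F) 1
      rw [hfin] at this
      simpa using this
    have h2 : Algebra.trace ℚ F (s * s) = 2 * d := by
      rw [← pow_two, hs]
      have := Algebra.trace_algebraMap (R := ℚ) (S := F) d
      rw [hfin] at this
      simpa using this
    rw [Algebra.discr_def, Matrix.det_fin_two]
    simp only [Algebra.traceMatrix_apply, Algebra.traceForm_apply, Matrix.cons_val_zero,
      Matrix.cons_val_one, one_mul, mul_one, htr, h1, h2]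
    ring
  have hsI : IsIntegral ℤ s := by
    refine ⟨Polynomial.X ^ 2 - Polynomial.C d, Polynomial.monic_X_pow_sub_C _ two_ne_zero, ?_⟩
    rw [Polynomial.eval₂_sub, Polynomial.eval₂_X_pow, Polynomial.eval₂_C, hs]
    simp
  let S : Fin 2 → 𝓞 F := ![1, ⟨s, hsI⟩]
  let b : Module.Basis (Fin 2) ℤ (𝓞 F) :=
    Module.finBasisOfFinrankEq ℤ (𝓞 F) ((NumberField.RingOfIntegers.rank F).trans hfin)
  let P : Matrix (Fin 2) (Fin 2) ℤ := fun i j => b.repr (S j) i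
  have hS : Matrix.vecMul b (P.map (algebraMap ℤ (𝓞 F))) = S := by
    funext j
    rw [← b.sum_repr (S j)]
    simp only [Matrix.vecMul, dotProduct, zsmul_eq_mul]
    exact Finset.sum_congr rfl fun i _ => mul_comm _ _
  have h1 := Algebra.discr_of_matrix_vecMul b P
  rw [hS, NumberField.discr_eq_discr] at h1
  refine ⟨P.det, ?_⟩
  rw [← h1]
  have h2 : ((Algebra.discr ℤ S : ℤ) : ℚ) = Algebra.discr ℚ ![(1 : F), s] := by
    rw [Algebra.discr_def, Algebra.discr_def]
    have : Algebra.traceMatrix ℚ ![(1 : F), s] = (Algebra.traceMatrix ℤ S).map (algebraMap ℤ ℚ) := by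
      ext i j
      simp only [Algebra.traceMatrix_apply, Algebra.traceForm_apply, Matrix.map_apply]
      rw [eq_intCast, Algebra.coe_trace_int]
      congr 1
      have hSc : ∀ i, algebraMap (𝓞 F) F (S i) = ![1, s] i := by
        intro i
        fin_cases i <;> rfl
      rw [← hSc, ← hSc, ← map_mul]
    rw [this]
    have := RingHom.map_det (algebraMap ℤ ℚ) (Algebra.traceMatrix ℤ S)
    rw [eq_intCast] at this
    rw [this]; rfl
  rw [hv] at h2
  exact_mod_cast h2.symm

theorem IsQuadraticFieldOf.legendreSym_discr (hF : IsQuadraticFieldOf d F) (hd : Squarefree d)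
    (hd1 : d ≠ 1) (p : ℕ) [Fact p.Prime] (hp : p ≠ 2) :
    legendreSym p (NumberField.discr F) = legendreSym p d := by
  obtain ⟨k, hk⟩ := hF.exists_sq_mul_discr hd hd1
  have hpp : Prime (p : ℤ) := Nat.prime_iff_prime_int.1 Fact.out
  have hp2 : ¬ (p : ℤ) ∣ 2 := fun h =>
    hp ((Nat.prime_dvd_prime_iff_eq Fact.out Nat.prime_two).1 (by exact_mod_cast h))
  -- Otherwise `p²` would divide `4d`, impossible for odd `p` and squarefree `d`.
  have hpk : ¬ (p : ℤ) ∣ k := by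
    rintro ⟨c, rfl⟩
    have h1 : (p : ℤ) * p ∣ 2 ^ 2 * d := ⟨c ^ 2 * NumberField.discr F, by linear_combination hk⟩
    have hc : IsCoprime ((p : ℤ) * p) (2 ^ 2) := by
      have : IsCoprime (p : ℤ) 2 := (Prime.coprime_iff_not_dvd hpp).2 hp2
      exact (IsCoprime.mul_left this this).pow_right
    exact hpp.not_isUnit (hd _ (hc.dvd_of_dvd_mul_left h1))
  have h1 : legendreSym p (4 * d) = legendreSym p d := by
    rw [show (4 * d : ℤ) = 2 ^ 2 * d by ring, legendreSym.mul, legendreSym.sq_one', one_mul]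
    rwa [Ne, ZMod.intCast_zmod_eq_zero_iff_dvd]
  rw [← h1, hk, legendreSym.mul, legendreSym.sq_one', one_mul]
  rwa [Ne, ZMod.intCast_zmod_eq_zero_iff_dvd]

end Discriminant

/-! ### Reciprocity for Jacobi symbols with signed numerator -/

section Reciprocity

open ZMod

/-- Replacing `q` by `-q ≡ 1 mod 4` absorbs the reciprocity sign; a negative `D` contributes `(-1/q)
= -1`. Applied to two primes `≡ 3 mod 4`, the signs of `D` cancel. -/
theorem jacobiSym.eq_sign_mul_of_three_mod_four {q : ℕ} (hq : q % 4 = 3) {D : ℤ} (hD : Odd D) :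
    jacobiSym D q = D.sign * jacobiSym (-q) D.natAbs := by
  have hn : Odd D.natAbs := Int.natAbs_odd.2 hD
  have hqo : Odd q := Nat.odd_iff.2 (by omega)
  have key : jacobiSym D.natAbs q = jacobiSym (-q) D.natAbs := by
    rw [jacobiSym.neg _ hn]
    rcases Nat.odd_mod_four_iff.1 (Nat.odd_iff.1 hn) with h | h
    · rw [jacobiSym.quadratic_reciprocity_one_mod_four h hqo, χ₄_nat_one_mod_four h, one_mul]
    · rw [jacobiSym.quadratic_reciprocity_three_mod_four h hq, χ₄_nat_three_mod_four h]; ring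
  have hD0 : D ≠ 0 := by rintro rfl; simp at hD
  rcases lt_or_gt_of_ne hD0 with h | h
  · rw [Int.sign_eq_neg_one_of_neg h, ← key]
    have : D = -(D.natAbs : ℤ) := by omega
    conv_lhs => rw [this, jacobiSym.neg _ hqo, χ₄_nat_three_mod_four hq]
  · rw [Int.sign_eq_one_of_pos h, ← key, one_mul]
    have : D = (D.natAbs : ℤ) := by omega
    conv_lhs => rw [this]

theorem jacobiSym.eq_mul_of_three_mod_four {p q h : ℕ} (hp : p % 4 = 3) (hq : q % 4 = 3) {D : ℤ}
    (hD : Odd D) (hqp : (q : ℤ) ≡ h * p [ZMOD D.natAbs]) :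
    jacobiSym D q = jacobiSym h D.natAbs * jacobiSym D p := by
  rw [eq_sign_mul_of_three_mod_four hq hD, eq_sign_mul_of_three_mod_four hp hD,
    jacobiSym.mod_left' (hqp.neg), neg_mul_eq_mul_neg, jacobiSym.mul_left]
  ring

theorem jacobiSym.eq_mul_of_one_mod_four {p q : ℕ} (hp : p % 4 = 3) (hq : q % 4 = 1) {D : ℤ}
    (hD : Odd D) (hqp : (q : ℤ) ≡ p [ZMOD D.natAbs]) :
    jacobiSym D q = χ₄ D * jacobiSym D p := by
  have hn : Odd D.natAbs := Int.natAbs_odd.2 hD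
  have hqo : Odd q := Nat.odd_iff.2 (by omega)
  have key : jacobiSym D q = jacobiSym p D.natAbs := by
    rw [← jacobiSym.mod_left' hqp, ← jacobiSym.quadratic_reciprocity_one_mod_four' hn hq]
    rcases Int.natAbs_eq D with h | h
    · conv_lhs => rw [h]
    · conv_lhs => rw [h, jacobiSym.neg _ hqo, χ₄_nat_one_mod_four hq, one_mul]
  have hD0 : D ≠ 0 := by rintro rfl; simp at hD
  have hDo := Int.odd_iff.1 hD
  -- This is `χ₄ D = sign D · χ₄ |D|`, the whole discrepancy between the two residue classes mod
  -- `4`.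
  have hsgn : χ₄ D * D.sign * χ₄ D.natAbs = 1 := by
    rw [χ₄_int_eq_if_mod_four, χ₄_nat_eq_if_mod_four]
    rcases lt_or_gt_of_ne hD0 with h | h
    · rw [Int.sign_eq_neg_one_of_neg h]
      rcases (show D % 4 = 1 ∨ D % 4 = 3 by omega) with h4 | h4
      · have h5 : D.natAbs % 4 = 3 := by omega
        have h6 : D.natAbs % 2 = 1 := by omega
        simp [h4, h5, h6, hDo]
      · have h5 : D.natAbs % 4 = 1 := by omega
        have h6 : D.natAbs % 2 = 1 := by omega
        simp [h4, h5, h6, hDo]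
    · rw [Int.sign_eq_one_of_pos h]
      rcases (show D % 4 = 1 ∨ D % 4 = 3 by omega) with h4 | h4
      · have h5 : D.natAbs % 4 = 1 := by omega
        have h6 : D.natAbs % 2 = 1 := by omega
        simp [h4, h5, h6, hDo]
      · have h5 : D.natAbs % 4 = 3 := by omega
        have h6 : D.natAbs % 2 = 1 := by omega
        simp [h4, h5, h6, hDo]
  rw [key, eq_sign_mul_of_three_mod_four hp hD, jacobiSym.neg _ hn]
  linear_combination (-jacobiSym p D.natAbs) * hsgn

end Reciprocity

/-! ### Primes in prescribed residue classes -/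

section Dirichlet

theorem Int.exists_modEq_and_isCoprime {m n : ℕ} (hmn : m.Coprime n) {a b : ℤ}
    (ha : IsCoprime a m) (hb : IsCoprime b n) :
    ∃ x : ℤ, x ≡ a [ZMOD m] ∧ x ≡ b [ZMOD n] ∧ IsCoprime x (m * n : ℕ) := by
  obtain ⟨u, v, huv⟩ := Nat.isCoprime_iff_coprime.2 hmn
  have h1 : a * v * n + b * u * m = a + m * ((b - a) * u) := by linear_combination a * huv
  have h2 : a * v * n + b * u * m = b + n * ((a - b) * v) := by linear_combination b * huv
  refine ⟨a * v * n + b * u * m, ?_, ?_, ?_⟩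
  · rw [h1]; simp [Int.ModEq]
  · rw [h2]; simp [Int.ModEq]
  · push_cast
    refine IsCoprime.mul_right ?_ ?_
    · rw [h1]; exact ha.add_mul_left_left _
    · rw [h2]; exact hb.add_mul_left_left _

theorem Nat.exists_prime_gt_modEq_three {l m n : ℕ} (hl : l ≠ 0) (hm : m ≠ 0) (hn : n ≠ 0)
    (hlm : l.Coprime m) (hln : l.Coprime n) (hmn : m.Coprime n) {a b c : ℤ}
    (ha : IsCoprime a l) (hb : IsCoprime b m) (hc : IsCoprime c n) (N : ℕ) :
    ∃ q > N, q.Prime ∧ (q : ℤ) ≡ a [ZMOD l] ∧ (q : ℤ) ≡ b [ZMOD m] ∧ (q : ℤ) ≡ c [ZMOD n] := by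
  obtain ⟨x, hxa, hxb, hx⟩ := Int.exists_modEq_and_isCoprime hlm ha hb
  obtain ⟨y, hyx, hyc, hy⟩ := Int.exists_modEq_and_isCoprime (Nat.Coprime.mul_left hln hmn) hx hc
  obtain ⟨q, hqN, hq, hqy⟩ := Nat.forall_exists_prime_gt_and_zmodEq N
    (mul_ne_zero (mul_ne_zero hl hm) hn) hy
  have h1 : (q : ℤ) ≡ x [ZMOD (l * m : ℕ)] :=
    (hqy.of_dvd (by push_cast; exact dvd_mul_right _ _)).trans hyx
  refine ⟨q, hqN, hq, (h1.of_dvd (by push_cast; exact dvd_mul_right _ _)).trans hxa,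
    (h1.of_dvd (by push_cast; exact dvd_mul_left _ _)).trans hxb,
    (hqy.of_dvd (by push_cast; exact dvd_mul_left _ _)).trans hyc⟩

end Dirichlet

/-! ### Rational zeros from an auxiliary prime -/

/-- Local-global principle for `d * w ^ 2 - 2 * y ^ 2 = p * (x ^ 2 - 2 * z ^ 2)` in the presence of
an auxiliary prime `q`. -/
theorem exists_rat_zero_of_prime {d : ℤ} (hd0 : d ≠ 0) {p : ℕ} [Fact p.Prime] (hp : p ≠ 2)
    {q h k : ℕ} [Fact q.Prime] (hk : h * k = 2) (hq8 : q % 8 = 1 ∨ q % 8 = 7) (hqp : q ≠ p)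
    (hqd : ¬ (q : ℤ) ∣ d) (hdq : IsSquare (d : ZMod q))
    (hr : ∀ r : ℕ, r.Prime → r ≠ 2 → r ≠ p → (r : ℤ) ∣ d → IsSquare ((h * p * q : ℤ) : ZMod r))
    (hpd : (¬ (p : ℤ) ∣ d ∧ IsSquare ((2 * d : ℤ) : ZMod p)) ∨
      ∃ e : ℤ, d = p * e ∧ ¬ (p : ℤ) ∣ e ∧ IsSquare ((-(2 * e * (h * q)) : ℤ) : ZMod p)) :
    ∃ w x y z : ℚ, ¬(w = 0 ∧ x = 0 ∧ y = 0 ∧ z = 0) ∧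
      d * w ^ 2 - 2 * y ^ 2 = p * (x ^ 2 - 2 * z ^ 2) := by
  have hk2 : k ∣ 2 := Dvd.intro_left _ hk
  have hh2 : h ∣ 2 := Dvd.intro _ hk
  have hk0 : k ≠ 0 := by rintro rfl; simp at hk
  have hh0 : h ≠ 0 := by rintro rfl; simp at hk
  have hq0 : q ≠ 0 := (Fact.out : q.Prime).ne_zero
  have hp0 : p ≠ 0 := (Fact.out : p.Prime).ne_zero
  have hq2 : q ≠ 2 := by rintro rfl; simp at hq8
  have h2q : IsSquare ((2 : ℤ) : ZMod q) := by
    exact_mod_cast (ZMod.exists_sq_eq_two_iff hq2).2 hq8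
  have ndvd : ∀ {r s : ℕ}, r.Prime → s.Prime → r ≠ s → ¬ (r : ℤ) ∣ s := fun hr hs h hd =>
    h ((Nat.prime_dvd_prime_iff_eq hr hs).1 (by exact_mod_cast hd))
  have ndvd2 : ∀ {r s : ℕ}, r.Prime → r ≠ 2 → s ∣ 2 → ¬ (r : ℤ) ∣ s := fun hr h hs hd =>
    ndvd hr Nat.prime_two h (hd.trans (by exact_mod_cast hs))
  have c1 : ConicIsotropic ((2 : ℤ) : ℚ) ((-(k * q) : ℤ) : ℚ) := by
    refine ConicIsotropic.rat_of_local two_ne_zero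
      (neg_ne_zero.2 (mul_ne_zero (by exact_mod_cast hk0) (by exact_mod_cast hq0)))
      (.of_isSquare_left _ ⟨√2, by simp⟩) fun r _ hr2 => ?_
    have hrp : r.Prime := Fact.out
    have hri : Prime (r : ℤ) := Nat.prime_iff_prime_int.1 hrp
    have h2 : ¬ (r : ℤ) ∣ 2 := by exact_mod_cast ndvd2 hrp hr2 dvd_rfl
    rcases eq_or_ne r q with rfl | hrq
    · exact .padic_of_isSquare hr2 _ h2 h2q
    · refine .padic_of_not_dvd hr2 h2 ?_
      rw [dvd_neg, hri.dvd_mul, not_or]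
      exact ⟨ndvd2 hrp hr2 hk2, ndvd hrp Fact.out hrq⟩
  have c2 : ConicIsotropic ((2 * d : ℤ) : ℚ) ((h * p * q : ℤ) : ℚ) := by
    have hpos : (0 : ℤ) < h * p * q := by positivity
    refine ConicIsotropic.rat_of_local (mul_ne_zero two_ne_zero hd0) hpos.ne' ?_
      fun r _ hr2 => ?_
    · refine ConicIsotropic.symm (.of_isSquare_left _ ⟨√((h * p * q : ℤ) : ℝ), ?_⟩)
      rw [Real.mul_self_sqrt]
      exact_mod_cast hpos.le
    have hrp : r.Prime := Fact.out
    have hri : Prime (r : ℤ) := Nat.prime_iff_prime_int.1 hrp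
    have h2 : ¬ (r : ℤ) ∣ 2 := by exact_mod_cast ndvd2 hrp hr2 dvd_rfl
    have hrh : ¬ (r : ℤ) ∣ h := ndvd2 hrp hr2 hh2
    rcases eq_or_ne r q with rfl | hrq
    · refine .padic_of_isSquare hr2 _ (by rw [hri.dvd_mul]; tauto) ?_
      push_cast
      exact IsSquare.mul (by exact_mod_cast h2q) hdq
    have hrq' : ¬ (r : ℤ) ∣ q := ndvd hrp Fact.out hrq
    rcases eq_or_ne r p with rfl | hrp'
    · rcases hpd with ⟨h3, h4⟩ | ⟨e, rfl, he, h4⟩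
      · exact .padic_of_isSquare hr2 _ (by rw [hri.dvd_mul]; tauto) h4
      · have := ConicIsotropic.padic_of_dvd_of_dvd hr2 (a := 2 * e) (b := h * q)
          (by rw [hri.dvd_mul]; tauto) (by rw [hri.dvd_mul]; tauto) h4
        rw [show (r : ℤ) * (2 * e) = 2 * (r * e) by ring,
          show (r : ℤ) * (h * q) = h * r * q by ring] at this
        exact this
    have hrp'' : ¬ (r : ℤ) ∣ p := ndvd hrp Fact.out hrp'
    have hB : ¬ (r : ℤ) ∣ h * p * q := by rw [hri.dvd_mul, hri.dvd_mul]; tauto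
    by_cases hrd : (r : ℤ) ∣ d
    · exact (ConicIsotropic.padic_of_isSquare hr2 _ hB (hr r hrp hr2 hrp' hrd)).symm
    · exact .padic_of_not_dvd hr2 (by rw [hri.dvd_mul]; tauto) hB
  obtain ⟨x, z, v, n1, e1⟩ := c1
  obtain ⟨Y, w, t, n2, e2⟩ := c2
  push_cast at e1 e2
  have hk' : (h : ℚ) * k = 2 := by exact_mod_cast hk
  have hkq : (k : ℚ) ≠ 0 := by exact_mod_cast hk0
  have hqq : (q : ℚ) ≠ 0 := by exact_mod_cast hq0
  have hv : v ≠ 0 := by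
    rintro rfl
    have hz : z ≠ 0 := by
      rintro rfl
      exact n1 ⟨by simpa using e1, rfl, rfl⟩
    have hs : IsSquare ((2 : ℤ) : ℚ) := ⟨x / z, by push_cast; field_simp; linear_combination -e1⟩
    exact not_isSquare_ratCast_of_squarefree Int.prime_two.squarefree (by norm_num) hs
  -- The two conics say `x² - 2z² = -k q v²` and `Y² - 2d w² = h p q t²`. After this scaling both
  -- sides equal `-p q (t v)² / k`, because `h k = 2`.
  refine ⟨w * v, x * t / k, Y * v / 2, z * t / k, ?_, ?_⟩
  · rintro ⟨h1, h2, h3, h4⟩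
    have hw : w = 0 := by simpa [hv] using h1
    have hY : Y = 0 := by simpa [hv] using h3
    have ht : t ≠ 0 := fun h => n2 ⟨hY, hw, h⟩
    have hx : x = 0 := by simpa [ht, hkq] using h2
    have hz : z = 0 := by simpa [ht, hkq] using h4
    rw [hx, hz] at e1
    have : (k : ℚ) * q * v ^ 2 = 0 := by linear_combination e1
    simp [hkq, hqq, hv] at this
  · field_simp
    have e3 : x ^ 2 - 2 * z ^ 2 = -(k * q * v ^ 2) := by linear_combination e1
    linear_combination (-(k : ℚ) ^ 2 * v ^ 2 ) * e2 - 2 * p * t ^ 2 * e3 - k * p * q * v^2 * t^2 * hk'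

theorem jacobiSym.at_two_eq_one {n : ℕ} (h : n % 8 = 1 ∨ n % 8 = 7) : jacobiSym 2 n = 1 := by
  rw [jacobiSym.at_two (Nat.odd_iff.2 (by omega)), ZMod.χ₈_nat_eq_if_mod_eight]
  have h2 : n % 2 = 1 := by omega
  rcases h with h | h <;> simp [h, h2]

theorem jacobiSym.at_two_eq_neg_one {n : ℕ} (h : n % 8 = 3 ∨ n % 8 = 5) : jacobiSym 2 n = -1 := by
  rw [jacobiSym.at_two (Nat.odd_iff.2 (by omega)), ZMod.χ₈_nat_eq_if_mod_eight]
  have h2 : n % 2 = 1 := by omega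
  rcases h with h | h <;> simp [h, h2]

theorem exists_prime_gt_modEq {p : ℕ} [Fact p.Prime] (hp : p ≠ 2) {D : ℤ} (hD : Odd D)
    (hpD : ¬ (p : ℤ) ∣ D) {h c : ℕ} (hh : h ∣ 2) (hc : Odd c) {u : ℤ} (hu : ¬ (p : ℤ) ∣ u) (N : ℕ) :
    ∃ q > N, q.Prime ∧ q % 8 = c % 8 ∧ (q : ℤ) ≡ h * p [ZMOD D.natAbs] ∧ (q : ℤ) ≡ u [ZMOD p] := by
  have hpp : p.Prime := Fact.out
  have hpi : Prime (p : ℤ) := Nat.prime_iff_prime_int.1 hpp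
  have hpo : Odd p := hpp.odd_of_ne_two hp
  have hn : Odd D.natAbs := Int.natAbs_odd.2 hD
  have h8 : ∀ {n : ℕ}, Odd n → Nat.Coprime 8 n := fun hn =>
    Nat.Coprime.pow_left 3 (Nat.coprime_two_left.2 hn)
  have hDp : D.natAbs.Coprime p :=
    ((Nat.Prime.coprime_iff_not_dvd hpp).2 fun h => hpD (Int.natCast_dvd.2 h)).symm
  have hhD : h.Coprime D.natAbs := Nat.Coprime.coprime_dvd_left hh (Nat.coprime_two_left.2 hn)
  obtain ⟨q, hqN, hq, h1, h2, h3⟩ := Nat.exists_prime_gt_modEq_three (l := 8) (m := D.natAbs)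
    (n := p) (a := c) (b := h * p) (c := u) (by norm_num) hn.pos.ne' hpp.ne_zero (h8 hn) (h8 hpo)
    hDp (Nat.isCoprime_iff_coprime.2 (h8 hc).symm)
    (by exact_mod_cast Nat.isCoprime_iff_coprime.2 (hhD.mul_left hDp.symm))
    ((Prime.coprime_iff_not_dvd hpi).2 hu).symm N
  exact ⟨q, hqN, hq, by exact_mod_cast h1, h2, h3⟩

/-- The congruences turn the required residues into visible squares: `q ≡ h p` gives `h p q ≡ (h
p)²` mod `r`, and `q ≡ -k e` gives `-2 e h q ≡ (2e)²` mod `p`. The size of `q` keeps it away from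
`p` and the divisors of `d`. -/
theorem exists_rat_zero_of_modEq {d : ℤ} (hd0 : d ≠ 0) {p : ℕ} [Fact p.Prime] (hp : p ≠ 2)
    {q h k : ℕ} (hq : q.Prime) (hk : h * k = 2) (hq8 : q % 8 = 1 ∨ q % 8 = 7)
    (hqN : p + d.natAbs < q) {D : ℤ}
    (hD : ∀ r : ℕ, r.Prime → r ≠ 2 → r ≠ p → (r : ℤ) ∣ d → (r : ℤ) ∣ D)
    (hqD : (q : ℤ) ≡ h * p [ZMOD D.natAbs]) (hdq : jacobiSym d q = 1)
    (hpd : (¬ (p : ℤ) ∣ d ∧ jacobiSym (2 * d) p = 1) ∨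
      ∃ e : ℤ, d = p * e ∧ ¬ (p : ℤ) ∣ e ∧ (q : ℤ) ≡ -(k * e) [ZMOD p]) :
    ∃ w x y z : ℚ, ¬(w = 0 ∧ x = 0 ∧ y = 0 ∧ z = 0) ∧
      d * w ^ 2 - 2 * y ^ 2 = p * (x ^ 2 - 2 * z ^ 2) := by
  have : Fact q.Prime := ⟨hq⟩
  refine exists_rat_zero_of_prime hd0 hp hk hq8 (by omega) (fun h => ?_)
    (ZMod.isSquare_of_jacobiSym_eq_one hdq) (fun r hr hr2 hrp hrd => ?_) ?_
  · have := Nat.le_of_dvd (Int.natAbs_pos.2 hd0) (Int.natCast_dvd.1 h)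
    omega
  · have h1 : (q : ℤ) ≡ h * p [ZMOD r] :=
      hqD.of_dvd (Int.dvd_natAbs.2 (hD r hr hr2 hrp hrd))
    have h2 := (ZMod.intCast_eq_intCast_iff _ _ _).2 h1
    refine ⟨h * p, ?_⟩
    push_cast at h2 ⊢
    rw [h2]
  · refine hpd.imp (fun h => ⟨h.1, ZMod.isSquare_of_jacobiSym_eq_one h.2⟩) ?_
    rintro ⟨e, hde, hpe, hqe⟩
    refine ⟨e, hde, hpe, 2 * e, ?_⟩
    have h2 := (ZMod.intCast_eq_intCast_iff _ _ _).2 hqe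
    have h3 : (h : ZMod p) * k = 2 := by exact_mod_cast congrArg (Nat.cast : ℕ → ZMod p) hk
    push_cast at h2 ⊢
    rw [h2]
    linear_combination (2 * (e : ZMod p) ^ 2) * h3

theorem Int.odd_or_eq_two_mul_odd {d : ℤ} (hd : Squarefree d) :
    Odd d ∨ ∃ D : ℤ, d = 2 * D ∧ Odd D := by
  rcases Int.even_or_odd' d with ⟨D, h | h⟩
  · refine .inr ⟨D, h, Int.not_even_iff_odd.1 ?_⟩
    rintro ⟨E, hE⟩
    exact Int.prime_two.not_isUnit (hd 2 ⟨E, by omega⟩)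
  · exact .inl ⟨D, h⟩

/-! ### Choosing the auxiliary prime according to residues mod `8` -/

section Existence

variable {d : ℤ} {p : ℕ} [Fact p.Prime]

/-- Here `(d/q) = 1` has to be obtained from `(d/p) = -1`. The missing sign is `χ₄ d` for `d ≡ 7 mod
8`, `(2/|d|)` for `d ≡ 3, 5`, and `(2/p)` for even `d`; none is available when `d ≡ 1`. -/
theorem exists_rat_zero_of_not_dvd (hd : Squarefree d) (hp : p % 8 = 3)
    (h8 : ¬ d ≡ 1 [ZMOD 8]) (hJ : jacobiSym d p = -1) :
    ∃ w x y z : ℚ, ¬(w = 0 ∧ x = 0 ∧ y = 0 ∧ z = 0) ∧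
      d * w ^ 2 - 2 * y ^ 2 = p * (x ^ 2 - 2 * z ^ 2) := by
  have hpp : p.Prime := Fact.out
  have hpi : Prime (p : ℤ) := Nat.prime_iff_prime_int.1 hpp
  have hp2 : p ≠ 2 := by omega
  have hpd : ¬ (p : ℤ) ∣ d := fun h => by
    rw [jacobiSym.mod_left, Int.emod_eq_zero_of_dvd h, jacobiSym.zero_left hpp.one_lt] at hJ
    norm_num at hJ
  have h2p : jacobiSym 2 p = -1 := jacobiSym.at_two_eq_neg_one (.inl hp)
  have hJ2 : jacobiSym (2 * d) p = 1 := by rw [jacobiSym.mul_left, h2p, hJ]; norm_num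
  have hp1 : ¬ (p : ℤ) ∣ 1 := hpi.not_dvd_one
  rcases Int.odd_or_eq_two_mul_odd hd with ho | ⟨D, rfl, ho⟩
  · rcases (show d % 8 = 7 ∨ d % 8 = 3 ∨ d % 8 = 5 by
      have := Int.odd_iff.1 ho
      simp only [Int.ModEq] at h8
      omega) with h7 | h35
    · obtain ⟨q, hqN, hq, hq8, hqD, -⟩ := exists_prime_gt_modEq hp2 ho hpd (h := 1) (c := 1)
        (by norm_num) (by decide) hp1 (p + d.natAbs)
      refine exists_rat_zero_of_modEq hd.ne_zero hp2 hq (h := 1) (k := 2) (by norm_num) (.inl hq8)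
        hqN (fun r _ _ _ h => h) hqD ?_ (.inl ⟨hpd, hJ2⟩)
      rw [jacobiSym.eq_mul_of_one_mod_four (p := p) (by omega) (by omega) ho (by simpa using hqD), hJ,
        ZMod.χ₄_int_three_mod_four (by omega)]
      norm_num
    · obtain ⟨q, hqN, hq, hq8, hqD, -⟩ := exists_prime_gt_modEq hp2 ho hpd (h := 2) (c := 7)
        (by norm_num) (by decide) hp1 (p + d.natAbs)
      refine exists_rat_zero_of_modEq hd.ne_zero hp2 hq (h := 2) (k := 1) (by norm_num) (.inr hq8)
        hqN (fun r _ _ _ h => h) hqD ?_ (.inl ⟨hpd, hJ2⟩)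
      rw [jacobiSym.eq_mul_of_three_mod_four (p := p) (by omega) (by omega) ho hqD, hJ, Nat.cast_ofNat,
        jacobiSym.at_two_eq_neg_one (by omega)]
      norm_num
  · have hpD : ¬ (p : ℤ) ∣ D := fun h => hpd (h.mul_left _)
    obtain ⟨q, hqN, hq, hq8, hqD, -⟩ := exists_prime_gt_modEq hp2 ho hpD (h := 1) (c := 7)
      (by norm_num) (by decide) hp1 (p + (2 * D).natAbs)
    refine exists_rat_zero_of_modEq hd.ne_zero hp2 hq (h := 1) (k := 2) (by norm_num) (.inr hq8)
      hqN (fun r hr hr2 _ h => ?_) hqD ?_ (.inl ⟨hpd, hJ2⟩)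
    · refine ((Nat.prime_iff_prime_int.1 hr).dvd_or_dvd h).resolve_left fun h => hr2 ?_
      exact (Nat.prime_dvd_prime_iff_eq hr Nat.prime_two).1 (by exact_mod_cast h)
    · rw [jacobiSym.mul_left, h2p] at hJ
      rw [jacobiSym.mul_left, jacobiSym.at_two_eq_one (.inr hq8),
        jacobiSym.eq_mul_of_three_mod_four (p := p) (by omega) (by omega) ho hqD, Nat.cast_one,
        jacobiSym.one_left]
      linear_combination -hJ

/-- Solvability at `p` now fixes `q` mod `p`. In each case reciprocity makes `(p/q)` and the symbol
of the odd part of `e` at `q` the same symbol mod `p`, so `(d/q)` is a square. -/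
theorem exists_rat_zero_of_dvd (hd : Squarefree d) (hp : p % 8 = 3)
    (h8 : ¬ d ≡ 1 [ZMOD 8]) (hpd : (p : ℤ) ∣ d) :
    ∃ w x y z : ℚ, ¬(w = 0 ∧ x = 0 ∧ y = 0 ∧ z = 0) ∧
      d * w ^ 2 - 2 * y ^ 2 = p * (x ^ 2 - 2 * z ^ 2) := by
  have hpp : p.Prime := Fact.out
  have hpi : Prime (p : ℤ) := Nat.prime_iff_prime_int.1 hpp
  have hp2 : p ≠ 2 := by omega
  have hpo : Odd p := hpp.odd_of_ne_two hp2
  have hp2' : ¬ (p : ℤ) ∣ 2 := fun h =>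
    hp2 ((Nat.prime_dvd_prime_iff_eq hpp Nat.prime_two).1 (by exact_mod_cast h))
  have h2p : jacobiSym 2 p = -1 := jacobiSym.at_two_eq_neg_one (.inl hp)
  obtain ⟨e, rfl⟩ := hpd
  have hpe : ¬ (p : ℤ) ∣ e := by
    rintro ⟨f, rfl⟩
    exact hpi.not_isUnit (hd _ ⟨f, by ring⟩)
  have hJsq : ∀ {D : ℤ}, ¬ (p : ℤ) ∣ D → jacobiSym D p * jacobiSym D p = 1 := fun h => by
    rw [← pow_two, jacobiSym.sq_one]
    exact (Int.isCoprime_iff_gcd_eq_one.1 ((Prime.coprime_iff_not_dvd hpi).2 h).symm)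
  have hrD : ∀ r : ℕ, r.Prime → r ≠ p → (r : ℤ) ∣ p * e → (r : ℤ) ∣ e := fun r hr hrp h => by
    refine ((Nat.prime_iff_prime_int.1 hr).dvd_or_dvd h).resolve_left fun h => hrp ?_
    exact (Nat.prime_dvd_prime_iff_eq hr hpp).1 (by exact_mod_cast h)
  rcases Int.odd_or_eq_two_mul_odd (hd.squarefree_of_dvd (dvd_mul_left e p)) with ho | ⟨D, rfl, ho⟩
  · have hp8 : (p : ℤ) % 8 = 3 := by omega
    have hmod : (p * e : ℤ) % 8 = 3 * (e % 8) % 8 := by rw [Int.mul_emod, hp8]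
    have heo := Int.odd_iff.1 ho
    -- Since `p ≡ 3 mod 8`, the excluded class `d ≡ 1` is `e ≡ 3`.
    rcases (show e % 8 = 5 ∨ e % 8 = 1 ∨ e % 8 = 7 by
      simp only [Int.ModEq] at h8
      omega) with h5 | h17
    · obtain ⟨q, hqN, hq, hq8, hqD, hqp⟩ := exists_prime_gt_modEq hp2 ho hpe (h := 1) (c := 1)
        (u := -(2 * e)) (by norm_num) (by decide) (by rw [dvd_neg, hpi.dvd_mul]; tauto)
        (p + (p * e).natAbs)
      refine exists_rat_zero_of_modEq hd.ne_zero hp2 hq (h := 1) (k := 2) (by norm_num) (.inl hq8)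
        hqN (fun r hr _ hrp h => hrD r hr hrp h) hqD ?_ (.inr ⟨e, rfl, hpe, by exact_mod_cast hqp⟩)
      rw [jacobiSym.mul_left, jacobiSym.eq_mul_of_one_mod_four (p := p) (by omega) (by omega) ho
        (by simpa using hqD), ZMod.χ₄_int_one_mod_four (by omega),
        jacobiSym.quadratic_reciprocity_one_mod_four' hpo (by omega), jacobiSym.mod_left' hqp,
        jacobiSym.neg _ hpo, jacobiSym.mul_left, h2p, ZMod.χ₄_nat_three_mod_four (by omega)]
      linear_combination hJsq hpe
    · obtain ⟨q, hqN, hq, hq8, hqD, hqp⟩ := exists_prime_gt_modEq hp2 ho hpe (h := 2) (c := 7)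
        (u := -e) (by norm_num) (by decide) (by rwa [dvd_neg])
        (p + (p * e).natAbs)
      refine exists_rat_zero_of_modEq hd.ne_zero hp2 hq (h := 2) (k := 1) (by norm_num) (.inr hq8)
        hqN (fun r hr _ hrp h => hrD r hr hrp h) hqD ?_ (.inr ⟨e, rfl, hpe, by simpa using hqp⟩)
      rw [jacobiSym.mul_left, jacobiSym.eq_mul_of_three_mod_four (p := p) (by omega) (by omega) ho
        hqD, Nat.cast_ofNat, jacobiSym.at_two_eq_one (by omega),
        jacobiSym.quadratic_reciprocity_three_mod_four (by omega) (by omega),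
        jacobiSym.mod_left' hqp, jacobiSym.neg _ hpo, ZMod.χ₄_nat_three_mod_four (by omega)]
      linear_combination hJsq hpe
  · have hpD : ¬ (p : ℤ) ∣ D := fun h => hpe (h.mul_left _)
    obtain ⟨q, hqN, hq, hq8, hqD, hqp⟩ := exists_prime_gt_modEq hp2 ho hpD (h := 1) (c := 7)
      (u := -(2 * (2 * D))) (by norm_num) (by decide)
      (by rw [dvd_neg, hpi.dvd_mul, hpi.dvd_mul]; tauto) (p + (p * (2 * D)).natAbs)
    refine exists_rat_zero_of_modEq hd.ne_zero hp2 hq (h := 1) (k := 2) (by norm_num) (.inr hq8)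
      hqN (fun r hr hr2 hrp h => ?_) hqD ?_ (.inr ⟨2 * D, rfl, hpe, by exact_mod_cast hqp⟩)
    · refine ((Nat.prime_iff_prime_int.1 hr).dvd_or_dvd (hrD r hr hrp h)).resolve_left
        fun h => hr2 ?_
      exact (Nat.prime_dvd_prime_iff_eq hr Nat.prime_two).1 (by exact_mod_cast h)
    · rw [jacobiSym.mul_left, jacobiSym.mul_left, jacobiSym.at_two_eq_one (.inr hq8),
        jacobiSym.eq_mul_of_three_mod_four (p := p) (by omega) (by omega) ho hqD, Nat.cast_one,
        jacobiSym.one_left, jacobiSym.quadratic_reciprocity_three_mod_four (by omega) (by omega),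
        jacobiSym.mod_left' hqp, jacobiSym.neg _ hpo, jacobiSym.mul_left, jacobiSym.mul_left, h2p,
        ZMod.χ₄_nat_three_mod_four (by omega)]
      linear_combination hJsq hpD

theorem exists_rat_zero (hd : Squarefree d) (hp : p % 8 = 3)
    (h8 : ¬ d ≡ 1 [ZMOD 8]) (hJ : legendreSym p d ≠ 1) :
    ∃ w x y z : ℚ, ¬(w = 0 ∧ x = 0 ∧ y = 0 ∧ z = 0) ∧
      d * w ^ 2 - 2 * y ^ 2 = p * (x ^ 2 - 2 * z ^ 2) := by
  by_cases hpd : (p : ℤ) ∣ d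
  · exact exists_rat_zero_of_dvd hd hp h8 hpd
  · refine exists_rat_zero_of_not_dvd hd hp h8 ?_
    rw [← jacobiSym.legendreSym.to_jacobiSym]
    exact (legendreSym.eq_one_or_neg_one p
      (by rwa [Ne, ZMod.intCast_zmod_eq_zero_iff_dvd])).resolve_left hJ

end Existence

/-! ### The division criterion -/

theorem odd_finrank_of_dihedral_or_unramified {l : ℕ} (hl2 : Odd l) {F K : Type*} [Field F]
    [NumberField F] [Field K] [NumberField K] [Algebra F K]
    (hK : IsDihedralExtension l F K ∨ IsUnramifiedAbelianExtension l F K) :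
    Odd (Module.finrank F K) := by
  rcases hK with ⟨-, -, h⟩ | ⟨-, -, -, ⟨n, -, h⟩, -⟩
  · rwa [h]
  · rw [h]; exact hl2.pow

theorem mainTheorem3 (d : ℤ) (hd : Squarefree d) (hd1 : d ≠ 1)
    (F : Type*) [Field F] [NumberField F] (hF : IsQuadraticFieldOf d F)
    (l : ℕ) (hl : l.Prime) (hl2 : Odd l)
    (K : Type*) [Field K] [NumberField K] [Algebra F K]
    (hK : IsDihedralExtension l F K ∨ IsUnramifiedAbelianExtension l F K)
    (p : ℕ) [Fact p.Prime] (hp : p ≡ 3 [MOD 8]) :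
    IsDivisionAlgebra ℍ[K, (p : K), (2 : K)] ↔
      (legendreSym p (NumberField.discr F) = 1 ∨ d ≡ 1 [ZMOD 8]) := by
  have hp8 : p % 8 = 3 := hp
  rw [hF.legendreSym_discr hd hd1 p (by omega)]
  constructor
  · intro hD
    by_contra! hcon
    obtain ⟨w, x, y, z, h0, h⟩ := exists_rat_zero hd hp8 hcon.2 hcon.1
    obtain ⟨s, hs, -⟩ := hF
    have hs0 : algebraMap F K s ≠ 0 := by
      rw [Ne, FaithfulSMul.algebraMap_eq_zero_iff]
      rintro rfl
      have : (d : F) = 0 := by rw [← hs]; simp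
      exact hd.ne_zero (by exact_mod_cast this)
    have hs' : (algebraMap F K s) ^ 2 = d := by rw [← map_pow, hs, map_intCast]
    have h' : (d : K) * w ^ 2 - 2 * y ^ 2 = p * (x ^ 2 - 2 * z ^ 2) := by
      exact_mod_cast congrArg (Rat.cast : ℚ → K) h
    refine not_isDivisionAlgebra_of_norm_eq_zero
      (q := (⟨algebraMap F K s * w, x, y, z⟩ : ℍ[K, (p : K), (2 : K)])) (fun hq => h0 ?_) ?_ hD
    · have h1 := congrArg QuaternionAlgebra.re hq
      have h2 := congrArg QuaternionAlgebra.imI hq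
      have h3 := congrArg QuaternionAlgebra.imJ hq
      have h4 := congrArg QuaternionAlgebra.imK hq
      simp only [QuaternionAlgebra.re_zero, QuaternionAlgebra.imI_zero, QuaternionAlgebra.imJ_zero,
        QuaternionAlgebra.imK_zero, mul_eq_zero, hs0, false_or, Rat.cast_eq_zero] at h1 h2 h3 h4
      exact ⟨h1, h2, h3, h4⟩
    · simp only
      linear_combination h' + (w : K) ^ 2 * hs'
  · intro h
    refine isDivisionAlgebra_of_not_conicIsotropic fun hc => ?_
    have hcF : ConicIsotropic (p : F) 2 := by
      refine ConicIsotropic.of_odd_finrank (K := K)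
        (odd_finrank_of_dihedral_or_unramified hl2 hK) two_ne_zero ?_
      rwa [map_natCast, map_ofNat]
    -- A square root of `d` in `L` embeds `F` in `L` and carries the point along; it is used with `L
    -- = ℚ_p` and `L = ℚ_2`.
    have key : ∀ {L : Type} [Field L] [CharZero L], IsSquare (d : L) → ConicIsotropic (p : L) 2 := by
      intro L _ _ hs
      obtain ⟨f⟩ := hF.exists_ringHom hd hd1 hs
      have := hcF.map f
      rwa [map_natCast, map_ofNat] at this
    rcases h with h | h
    · have hpd : ¬ (p : ℤ) ∣ d := fun h1 => by
        rw [(legendreSym.eq_zero_iff p d).2 (by rwa [ZMod.intCast_zmod_eq_zero_iff_dvd])] at h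
        norm_num at h
      refine not_conicIsotropic_padic_self hp8 (key ?_)
      refine Padic.isSquare_intCast_of_zmod (by omega) hpd ((legendreSym.eq_one_iff p ?_).1 h)
      rwa [Ne, ZMod.intCast_zmod_eq_zero_iff_dvd]
    · exact not_conicIsotropic_padic_two hp8 (key (Padic.isSquare_intCast_two h))
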